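/- Let $q>1$ be a prime power with prime divisor $p$, let $n\ge 2$ be an integer, and let $E/F$ be an extension of finite fields with $|F|=q$ and $[E:F]=n$. For a positive integer $m$ write $m'$ for the $p$-free part of $m$ (so $m=p^a m'$ with $p\nmid m'$), and for an integer $a$ coprime to $m$ let $\mathrm{ord}_m(a)$ be the least integer $k\ge 1$ with $a^k\equiv 1 \pmod m$. For a divisor $d$ of $n$ let $\mathbb F_{q^d}$ be the unique intermediate field of $E/F$ of degree $d$ over $F$. For an intermediate field $K$ of $E/F$ with $|K|=Q$ and $[E:K]=m$, an element $w\in E$ is called normal over $K$ if $w,w^{Q},\dots,w^{Q^{m-1}}$ form a $K$-basis of $E$; and $w$ is called completely normal over $F$ if it is normal over every intermediate field $K$ of $E/F$. The CN-digraph $\Gamma$ associated to $(q,n)$ is the directed graph whose vertices are the positive divisors $d$ of $n$ with $d\neq n$, where for two distinct vertices $d,e$ there is an arc $d\to e$ if and only if $d\mid e$, $r:=e/d$ is a prime number, and $r$ does not divide $\mathrm{ord}_{(n/e)'}(q^d)$. Let $\mathcal D^*$ be the set of all vertices of $\Gamma$ having indegree $0$, i.e. those vertices $t$ for which there is no vertex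 $s$ with an arc $s\to t$. Then $\mathcal D^*$ is $(q,n)$-essential: it is a set of divisors of $n$, and an element $w\in E$ is completely normal over $F$ if and only if $w$ is normal over $\mathbb F_{q^d}$ for every $d\in\mathcal D^*$. -/

import Mathlib

/-- For a prime power `q`, the `p`-free part `m'` of `m`, where `p` is the characteristic, i.e. the
unique prime divisor of `q`, which is the least prime factor `q.minFac` of `q`. -/
def charFreePart (q m : ℕ) : ℕ := ordCompl[q.minFac] m

/-- The order of `a` modulo `m`: the least `k ≥ 1` with `a ^ k ≡ 1 mod m` (for `a` prime to `m`). -/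
noncomputable def ordMod (m a : ℕ) : ℕ := orderOf (a : ZMod m)

/-- The defining property of `ordMod` for coprime arguments. -/
theorem ordMod_isLeast {m a : ℕ} (hm : 0 < m) (h : a.Coprime m) :
    IsLeast {k : ℕ | 1 ≤ k ∧ a ^ k ≡ 1 [MOD m]} (ordMod m a) := by
  have key : ∀ k : ℕ, a ^ k ≡ 1 [MOD m] ↔ (a : ZMod m) ^ k = 1 := fun k => by
    rw [← ZMod.natCast_eq_natCast_iff]
    push_cast
    rfl
  refine ⟨⟨?_, (key _).2 (pow_orderOf_eq_one _)⟩, fun k hk => ?_⟩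
  · refine orderOf_pos_iff.2 (isOfFinOrder_iff_pow_eq_one.2 ⟨m.totient, ?_, ?_⟩)
    · exact Nat.totient_pos.2 hm
    · exact (key _).1 (Nat.ModEq.pow_totient h)
  · exact orderOf_le_of_pow_eq_one hk.1 ((key _).1 hk.2)

/-- The CN-digraph associated to the pair `(q, n)`: its vertices are the positive divisors of `n`
different from `n`; there is an arc from `d` to `e` iff `d ≠ e`, `d ∣ e`, `r := e / d` is prime, and
`r` does not divide the order of `q ^ d` modulo `(n / e)'`. -/
def cnDigraph (q n : ℕ) : Digraph {d : ℕ // d ∈ n.properDivisors} where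
  Adj d e := d ≠ e ∧ d.1 ∣ e.1 ∧ (e.1 / d.1).Prime ∧
    ¬ (e.1 / d.1 ∣ ordMod (charFreePart q (n / e.1)) (q ^ d.1))

/-- The set `D*` of all vertices of the CN-digraph with indegree `0`, as a set of integers. -/
def cnSources (q n : ℕ) : Set ℕ :=
  {t | ∃ ht : t ∈ n.properDivisors, ∀ s, ¬ (cnDigraph q n).Adj s ⟨t, ht⟩}

/-- For an extension `E/K` of finite fields with `|K| = Q` and degree `m`, the element `w` of `E` is
normal over `K` if its conjugates `w, w ^ Q, …, w ^ (Q ^ (m - 1))` form a `K`-basis of `E`. -/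
def IsNormalElement (K : Type*) {E : Type*} [Field K] [Field E] [Algebra K E] (w : E) : Prop :=
  LinearIndependent K (fun i : Fin (Module.finrank K E) => w ^ (Nat.card K ^ (i : ℕ))) ∧
    Submodule.span K
      (Set.range (fun i : Fin (Module.finrank K E) => w ^ (Nat.card K ^ (i : ℕ)))) = ⊤

/-- An element of `E` is completely normal over `F` if it is normal over every intermediate field
of `E/F`. -/
def IsCompletelyNormal (F : Type*) {E : Type*} [Field F] [Field E] [Algebra F E] (w : E) : Prop :=
  ∀ K : IntermediateField F E, IsNormalElement K w

/-- The intermediate field `𝔽_{q^d}` of an extension `E/F` of finite fields with `|F| = q`, consisting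
of the `x ∈ E` with `x ^ (q ^ d) = x`. It has degree `d` over `F` when `d` divides the degree of
`E/F`. -/
def intermediateOfDegree (F E : Type*) [Field F] [Finite F] [Field E] [Algebra F E] (d : ℕ) :
    IntermediateField F E where
  carrier := {x | x ^ (Nat.card F ^ d) = x}
  mul_mem' {x y} hx hy := by
    simp only [Set.mem_ofPred_eq] at hx hy ⊢
    rw [mul_pow, hx, hy]
  add_mem' {x y} hx hy := by
    have := Fintype.ofFinite F
    simp only [Set.mem_ofPred_eq, Nat.card_eq_fintype_card] at hx hy ⊢
    have h : ∀ z : E, (FiniteField.frobeniusAlgHom F E ^ d) z = z ^ (Fintype.card F ^ d) := by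
      intro z
      rw [AlgHom.coe_pow, FiniteField.coe_frobeniusAlgHom, pow_iterate]
    rw [← h, map_add, h, h, hx, hy]
  algebraMap_mem' x := by
    have := Fintype.ofFinite F
    simp only [Set.mem_ofPred_eq, Nat.card_eq_fintype_card]
    rw [← map_pow, FiniteField.pow_card_pow]
  inv_mem' x hx := by
    simp only [Set.mem_ofPred_eq] at hx ⊢
    rw [inv_pow, hx]

/-- `intermediateOfDegree F E d` has degree `d` over `F` if `d` divides the degree of `E/F`. -/
theorem finrank_intermediateOfDegree (F E : Type*) [Field F] [Finite F] [Field E] [Finite E]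
    [Algebra F E] {d : ℕ} (hd : d ∣ Module.finrank F E) :
    Module.finrank F (intermediateOfDegree F E d) = d := by
  have := Fintype.ofFinite F
  set σ := FiniteField.frobeniusAlgEquivOfAlgebraic F E with hσ
  have hn : 0 < Module.finrank F E := Module.finrank_pos
  have hd0 : d ≠ 0 := fun h => by
    rw [h, zero_dvd_iff] at hd
    omega
  have h1 : intermediateOfDegree F E d = IntermediateField.fixedField (Subgroup.zpowers (σ ^ d)) := by
    ext x
    have hx : (σ ^ d) x = x ^ (Nat.card F ^ d) := by
      rw [AlgEquiv.coe_pow, hσ, FiniteField.coe_frobeniusAlgEquivOfAlgebraic_iterate,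
        Nat.card_eq_fintype_card]
    rw [IntermediateField.mem_fixedField_iff]
    change x ^ (Nat.card F ^ d) = x ↔ _
    rw [← hx]
    constructor
    · intro h f hf
      have hs : Subgroup.zpowers (σ ^ d) ≤ MulAction.stabilizer Gal(E/F) x :=
        Subgroup.zpowers_le.2 (MulAction.mem_stabilizer_iff.2 h)
      exact MulAction.mem_stabilizer_iff.1 (hs hf)
    · intro h
      exact h _ (Subgroup.mem_zpowers _)
  have h2 : Module.finrank (intermediateOfDegree F E d) E = Module.finrank F E / d := by
    rw [h1, IntermediateField.finrank_fixedField_eq_card, Nat.card_zpowers,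
      orderOf_pow' _ hd0, hσ, FiniteField.orderOf_frobeniusAlgEquivOfAlgebraic,
      Nat.gcd_eq_right hd]
  have h3 := Module.finrank_mul_finrank F (intermediateOfDegree F E d) E
  obtain ⟨c, hc⟩ := hd
  rw [h2, hc, Nat.mul_div_cancel_left _ (Nat.pos_of_ne_zero hd0)] at h3
  refine Nat.eq_of_mul_eq_mul_right (Nat.pos_of_ne_zero ?_) h3
  rintro rfl
  simp at hc
  omega

/-- A set `D` of divisors of `n`, the degree of the extension `E/F` of finite fields, is
`E/F`-essential if an element of `E` is completely normal over `F` iff it is normal over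
`𝔽_{q^d}` for every `d ∈ D`, where `q = |F|`. -/
def IsEssential (F E : Type*) [Field F] [Finite F] [Field E] [Algebra F E] (D : Set ℕ) : Prop :=
  D ⊆ {d : ℕ | d ∣ Module.finrank F E} ∧
    ∀ w : E, IsCompletelyNormal F w ↔ ∀ d ∈ D, IsNormalElement (intermediateOfDegree F E d) w

open Polynomial

/-! Let the Frobenius of `E/K` act on `E`, making `E` a `K[X]`-module; `w` is normal over `K` iff no
nonzero polynomial of degree below `[E:K]` kills `w`. The core is `IsNormalElement.of_tower`, for `K
⊆ L ⊆ E` with `r = [L:K]` and `k = [E:L]`. If `w` is not normal over `L`, a monic divisor `f` of `X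
^ k - 1` of degree below `k` kills it. The roots of `f` are `k'`-th roots of unity, so the
congruence `|K| ^ s ≡ 1` mod `k'` puts the coefficients of `f` in the field of `|K| ^ s` elements.
They also lie in `L`, and `s` is prime to `r`, so they lie in `K`. Then `f(X ^ r)` over `K` kills
`w` and has degree below `rk = [E:K]`: `w` is not normal over `K`. Hence normality passes along
every arc of the digraph, and descending from a vertex along incoming arcs ends at a source. -/

lemma aeval_frobenius_apply {K E : Type*} [Field K] [Fintype K] [Field E] [Algebra K E]
    {m : ℕ} (g : K[X]) (hg : g.natDegree < m) (w : E) :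
    aeval (FiniteField.frobeniusAlgHom K E).toLinearMap g w =
      ∑ i : Fin m, g.coeff i • w ^ (Nat.card K ^ (i : ℕ)) := by
  rw [aeval_eq_sum_range' hg, Finset.sum_range, LinearMap.sum_apply]
  refine Finset.sum_congr rfl fun i _ => ?_
  rw [LinearMap.smul_apply, Module.End.coe_pow, AlgHom.coe_toLinearMap,
    FiniteField.coe_frobeniusAlgHom, pow_iterate, Nat.card_eq_fintype_card]

/-- A normal element is annihilated by no nonzero polynomial in the Frobenius of degree less than
the degree of the extension. -/
lemma IsNormalElement.eq_zero_of_aeval {K E : Type*} [Field K] [Fintype K] [Field E] [Algebra K E]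
    {w : E} (hw : IsNormalElement K w) {g : K[X]} (hg : g.natDegree < Module.finrank K E)
    (h : aeval (FiniteField.frobeniusAlgHom K E).toLinearMap g w = 0) : g = 0 := by
  rw [aeval_frobenius_apply g hg] at h
  have h2 := Fintype.linearIndependent_iff.1 hw.1 _ h
  ext i
  rw [coeff_zero]
  rcases lt_or_ge i (Module.finrank K E) with hi | hi
  · exact h2 ⟨i, hi⟩
  · exact coeff_eq_zero_of_natDegree_lt (hg.trans_le hi)

lemma isNormalElement_of_forall_aeval {K E : Type*} [Field K] [Fintype K] [Field E] [Finite E]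
    [Algebra K E] {w : E}
    (h : ∀ g : K[X], g.natDegree < Module.finrank K E →
      aeval (FiniteField.frobeniusAlgHom K E).toLinearMap g w = 0 → g = 0) :
    IsNormalElement K w := by
  have hpos : 0 < Module.finrank K E := Module.finrank_pos
  have hli : LinearIndependent K
      (fun i : Fin (Module.finrank K E) => w ^ (Nat.card K ^ (i : ℕ))) := by
    refine Fintype.linearIndependent_iff.2 fun c hc i => ?_
    have hcoeff : ∀ j : Fin (Module.finrank K E),
        (∑ i : Fin (Module.finrank K E), monomial (i : ℕ) (c i)).coeff j = c j := fun j => by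
      simp [finsetSum_coeff, coeff_monomial, Fin.val_inj]
    have hdeg : (∑ i : Fin (Module.finrank K E), monomial (i : ℕ) (c i)).natDegree <
        Module.finrank K E := by
      refine lt_of_le_of_lt (natDegree_sum_le_of_forall_le (n := Module.finrank K E - 1) _ _
        fun i _ => (natDegree_monomial_le _).trans (by omega)) (by omega)
    have h0 := h _ hdeg (by
      rw [aeval_frobenius_apply _ hdeg, ← hc]
      exact Finset.sum_congr rfl fun j _ => by rw [hcoeff])
    rw [← hcoeff i, h0, coeff_zero]
  exact ⟨hli, hli.span_eq_top_of_card_eq_finrank' (by simp)⟩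

/-- If every `k`-th root of unity is fixed by `x ↦ x ^ N`, then so are the coefficients of the
monic divisors of `X ^ k - 1`. -/
lemma coeff_pow_eq_of_dvd_X_pow_sub_one {L : Type*} [Field L] {p : ℕ} [Fact p.Prime] [CharP L p]
    {k t j : ℕ} (ht : p ^ t ≡ 1 [MOD ordCompl[p] k])
    (hj : p ^ t = j) {f : L[X]} (hf : f.Monic) (hdvd : f ∣ X ^ k - 1) (i : ℕ) :
    f.coeff i ^ j = f.coeff i := by
  subst hj
  let A := AlgebraicClosure L
  have : CharP A p := charP_of_injective_algebraMap (algebraMap L A).injective p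
  have hroot : ∀ z ∈ (f.map (algebraMap L A)).roots, iterateFrobenius A p t z = z := by
    intro z hz
    have h0 : eval z (X ^ k - 1 : A[X]) = 0 := by
      have hd : f.map (algebraMap L A) ∣ X ^ k - 1 := by
        simpa using Polynomial.map_dvd (algebraMap L A) hdvd
      exact eval_eq_zero_of_dvd_of_eval_eq_zero hd (isRoot_of_mem_roots hz)
    have h1 : z ^ k = 1 := by simpa [sub_eq_zero] using h0
    -- The `p`-part of `k` can be dropped because Frobenius is injective.
    have h2 : z ^ ordCompl[p] k = 1 := by
      apply iterateFrobenius_inj A p (k.factorization p)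
      rw [map_one, iterateFrobenius_def, ← pow_mul, mul_comm, Nat.ordProj_mul_ordCompl_eq_self, h1]
    rw [iterateFrobenius_def, pow_eq_pow_of_modEq ht h2, pow_one]
  have hs := IsAlgClosed.splits (f.map (algebraMap L A))
  have hprod := hs.eq_prod_roots_of_monic (hf.map _)
  have hfix : (f.map (algebraMap L A)).map (iterateFrobenius A p t) = f.map (algebraMap L A) := by
    conv_lhs => rw [hprod]
    conv_rhs => rw [hprod]
    rw [Polynomial.map_multiset_prod, Multiset.map_map]
    congr 1
    refine Multiset.map_congr rfl fun z hz => ?_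
    simp [hroot z hz]
  apply (algebraMap L A).injective
  have := congrArg (fun g => g.coeff i) hfix
  simpa [iterateFrobenius_def] using this

lemma exists_algebraMap_eq_of_pow_card_eq {K L : Type*} [Field K] [Fintype K] [Field L]
    [Algebra K L] {c : L} (hc : c ^ Fintype.card K = c) : ∃ a : K, algebraMap K L a = c := by
  classical
  have hne : (X ^ Fintype.card K - X : L[X]) ≠ 0 :=
    FiniteField.X_pow_card_sub_X_ne_zero L Fintype.one_lt_card
  have hsub : Finset.univ.image (algebraMap K L) ⊆ (X ^ Fintype.card K - X : L[X]).roots.toFinset := by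
    intro x hx
    obtain ⟨a, -, rfl⟩ := Finset.mem_image.1 hx
    rw [Multiset.mem_toFinset, mem_roots hne]
    simp [← map_pow, FiniteField.pow_card]
  have heq := Finset.eq_of_subset_of_card_le hsub (by
    rw [Finset.card_image_of_injective _ (algebraMap K L).injective, Finset.card_univ]
    exact (Multiset.toFinset_card_le _).trans ((card_roots' _).trans
      (FiniteField.X_pow_card_sub_X_natDegree_eq L Fintype.one_lt_card).le))
  have hmem : c ∈ Finset.univ.image (algebraMap K L) := by
    rw [heq, Multiset.mem_toFinset, mem_roots hne]
    simp [hc]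
  simpa using hmem

/-- The Frobenius of `L` is the `[L:K]`-th power of that of `K`. -/
lemma aeval_frobenius_map_eq_aeval_expand {K L E : Type*} [Field K] [Fintype K] [Field L] [Fintype L] [Field E]
    [Algebra K L] [Algebra L E] [Algebra K E] [IsScalarTower K L E] (f : K[X]) (w : E) :
    aeval (FiniteField.frobeniusAlgHom L E).toLinearMap (f.map (algebraMap K L)) w =
      aeval (FiniteField.frobeniusAlgHom K E).toLinearMap (expand K (Module.finrank K L) f) w := by
  rw [expand_aeval, aeval_eq_sum_range' (Nat.lt_succ_self _), natDegree_map,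
    aeval_eq_sum_range' (Nat.lt_succ_self _), LinearMap.sum_apply, LinearMap.sum_apply]
  refine Finset.sum_congr rfl fun i _ => ?_
  rw [coeff_map, LinearMap.smul_apply, LinearMap.smul_apply, algebraMap_smul, ← pow_mul,
    Module.End.coe_pow, Module.End.coe_pow, AlgHom.coe_toLinearMap, AlgHom.coe_toLinearMap,
    FiniteField.coe_frobeniusAlgHom, FiniteField.coe_frobeniusAlgHom, pow_iterate, pow_iterate,
    Module.card_eq_pow_finrank (K := K) (V := L), pow_mul]

lemma IsNormalElement.of_tower {K L E : Type*} [Field K] [Fintype K] [Field L] [Fintype L]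
    [Field E] [Finite E] [Algebra K L] [Algebra L E] [Algebra K E] [IsScalarTower K L E]
    {p a s : ℕ} [Fact p.Prime] (hcard : Fintype.card K = p ^ a)
    (hs : (Fintype.card K) ^ s ≡ 1 [MOD ordCompl[p] (Module.finrank L E)])
    (hcop : s.Coprime (Module.finrank K L)) {w : E} (hw : IsNormalElement K w) :
    IsNormalElement L w := by
  classical
  have hr : 0 < Module.finrank K L := Module.finrank_pos
  have : CharP K p := charP_of_card_eq_prime_pow hcard
  have : CharP L p := charP_of_injective_algebraMap (algebraMap K L).injective p
  refine isNormalElement_of_forall_aeval fun g hg hgw => ?_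
  by_contra hg0
  set k := Module.finrank L E
  set φ := (FiniteField.frobeniusAlgHom L E).toLinearMap
  have hannX : aeval φ (X ^ k - 1 : L[X]) w = 0 := by
    have hw' : w ^ Fintype.card L ^ k = w := by
      have := Fintype.ofFinite E
      rw [← Module.card_eq_pow_finrank (K := L) (V := E), FiniteField.pow_card]
    simp only [map_sub, map_pow, aeval_X, map_one, LinearMap.sub_apply, Module.End.one_apply, φ]
    rw [Module.End.coe_pow, AlgHom.coe_toLinearMap, FiniteField.coe_frobeniusAlgHom, pow_iterate]
    exact sub_eq_zero.2 hw'
  -- By Bézout the gcd still kills `w`.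
  set f := normalize (EuclideanDomain.gcd g (X ^ k - 1))
  have hgcd0 : EuclideanDomain.gcd g (X ^ k - 1 : L[X]) ≠ 0 := fun h =>
    hg0 (EuclideanDomain.gcd_eq_zero_iff.1 h).1
  have hmonic : f.Monic := monic_normalize hgcd0
  have hfg : f ∣ g := normalize_dvd_iff.2 (EuclideanDomain.gcd_dvd_left _ _)
  have hfX : f ∣ X ^ k - 1 := normalize_dvd_iff.2 (EuclideanDomain.gcd_dvd_right _ _)
  have hfw : aeval φ f w = 0 := by
    obtain ⟨u, hu⟩ := dvd_normalize_iff.2 (dvd_refl (EuclideanDomain.gcd g (X ^ k - 1 : L[X])))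
    obtain ⟨v, hv⟩ : EuclideanDomain.gcd g (X ^ k - 1 : L[X]) ∣ f := ⟨u, hu⟩
    rw [hv, EuclideanDomain.gcd_eq_gcd_ab, mul_comm, map_mul, Module.End.mul_apply, map_add,
      mul_comm g, mul_comm (X ^ k - 1 : L[X]), map_mul, map_mul, LinearMap.add_apply,
      Module.End.mul_apply, Module.End.mul_apply, hgw, hannX]
    simp
  have hdeg : f.natDegree < k := (natDegree_le_of_dvd hfg hg0).trans_lt hg
  have hcoeff : ∀ i, f.coeff i ∈ (algebraMap K L).range := fun i => by
    refine exists_algebraMap_eq_of_pow_card_eq ?_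
    have h1 : Function.IsPeriodicPt (fun x : L => x ^ Fintype.card K) s (f.coeff i) := by
      rw [Function.IsPeriodicPt, Function.IsFixedPt, pow_iterate]
      rw [hcard, ← pow_mul] at hs ⊢
      exact coeff_pow_eq_of_dvd_X_pow_sub_one hs rfl hmonic hfX i
    have h2 : Function.IsPeriodicPt (fun x : L => x ^ Fintype.card K) (Module.finrank K L)
        (f.coeff i) := by
      rw [Function.IsPeriodicPt, Function.IsFixedPt, pow_iterate,
        ← Module.card_eq_pow_finrank (K := K) (V := L)]
      exact FiniteField.pow_card _
    -- Periods `s` and `r` under `x ↦ x ^ |K|` give period `gcd(s, r) = 1`.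
    have h3 := h1.gcd h2
    rw [hcop] at h3
    exact h3
  obtain ⟨f', hf'⟩ := (mem_map_range _).2 hcoeff
  have hf' : f'.map (algebraMap K L) = f := hf'
  rw [← hf', aeval_frobenius_map_eq_aeval_expand] at hfw
  have h0 := hw.eq_zero_of_aeval (by
    rw [natDegree_expand, ← Module.finrank_mul_finrank K L E, mul_comm]
    rw [← hf', natDegree_map] at hdeg
    exact Nat.mul_lt_mul_of_pos_left hdeg hr) hfw
  rw [expand_eq_zero hr] at h0
  rw [h0, Polynomial.map_zero] at hf'
  exact hmonic.ne_zero hf'.symm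

lemma intermediateOfDegree_le (F E : Type*) [Field F] [Finite F] [Field E] [Algebra F E]
    {d e : ℕ} (h : d ∣ e) : intermediateOfDegree F E d ≤ intermediateOfDegree F E e := by
  obtain ⟨c, rfl⟩ := h
  intro x hx
  have hx : x ^ (Nat.card F ^ d) = x := hx
  change x ^ (Nat.card F ^ (d * c)) = x
  have h1 : Function.IsPeriodicPt (fun x : E => x ^ (Nat.card F ^ d)) 1 x := hx
  have h2 := h1.mul_const c
  rwa [one_mul, Function.IsPeriodicPt, Function.IsFixedPt, pow_iterate, ← pow_mul] at h2

lemma eq_intermediateOfDegree {F E : Type*} [Field F] [Finite F] [Field E] [Finite E]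
    [Algebra F E] (M : IntermediateField F E) :
    M = intermediateOfDegree F E (Module.finrank F M) := by
  have := Fintype.ofFinite F
  have := Fintype.ofFinite M
  refine IntermediateField.eq_of_le_of_finrank_eq (fun x hx => ?_) ?_
  · change x ^ (Nat.card F ^ Module.finrank F M) = x
    rw [Nat.card_eq_fintype_card, ← Module.card_eq_pow_finrank (K := F) (V := M)]
    exact congrArg Subtype.val (FiniteField.pow_card (⟨x, hx⟩ : M))
  · rw [finrank_intermediateOfDegree F E
      ⟨_, (Module.finrank_mul_finrank F M E).symm⟩]

lemma IsNormalElement.intermediateOfDegree_of_dvd {F E : Type*} [Field F] [Finite F] [Field E]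
    [Finite E] [Algebra F E] {d e s : ℕ} (hde : d ∣ e) (he : e ∣ Module.finrank F E)
    (hs : (Nat.card F ^ d) ^ s ≡ 1 [MOD charFreePart (Nat.card F) (Module.finrank F E / e)])
    (hcop : s.Coprime (e / d)) {w : E} (hw : IsNormalElement (intermediateOfDegree F E d) w) :
    IsNormalElement (intermediateOfDegree F E e) w := by
  set K := intermediateOfDegree F E d with hK
  set L := intermediateOfDegree F E e with hL
  have := Fintype.ofFinite F
  have := Fintype.ofFinite K
  have := Fintype.ofFinite L
  let : Algebra K L := (IntermediateField.inclusion (intermediateOfDegree_le F E hde)).toAlgebra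
  have : IsScalarTower K L E := IsScalarTower.of_algebraMap_eq fun _ => rfl
  have : IsScalarTower F K L := IsScalarTower.of_algebraMap_eq fun _ => rfl
  have hKd : Module.finrank F K = d := finrank_intermediateOfDegree F E (hde.trans he)
  have hLe : Module.finrank F L = e := finrank_intermediateOfDegree F E he
  have hn : 0 < Module.finrank F E := Module.finrank_pos
  have he0 : 0 < e := Nat.pos_of_dvd_of_pos he hn
  have hd0 : 0 < d := Nat.pos_of_dvd_of_pos hde he0
  have h1 := Module.finrank_mul_finrank F K L
  have h2 := Module.finrank_mul_finrank F L E
  rw [hKd, hLe] at h1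
  rw [hLe] at h2
  have hKL : Module.finrank K L = e / d := (Nat.div_eq_of_eq_mul_right hd0 h1.symm).symm
  have hLE : Module.finrank L E = Module.finrank F E / e :=
    (Nat.div_eq_of_eq_mul_right he0 h2.symm).symm
  obtain ⟨p, hchar⟩ := CharP.exists F
  obtain ⟨a, hp, ha⟩ := FiniteField.card F p
  have : Fact p.Prime := ⟨hp⟩
  have hcardK : Fintype.card K = Nat.card F ^ d := by
    rw [Module.card_eq_pow_finrank (K := F) (V := K), hKd, Nat.card_eq_fintype_card]
  refine IsNormalElement.of_tower (p := p) (a := a * d) (s := s) ?_ ?_ ?_ hw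
  · rw [hcardK, Nat.card_eq_fintype_card, ha, pow_mul]
  · rw [hcardK, hLE]
    -- `q = p ^ a` with `a ≠ 0`, so `q.minFac = p`.
    rwa [charFreePart, Nat.card_eq_fintype_card, ha, hp.pow_minFac a.ne_zero, ← ha,
      ← Nat.card_eq_fintype_card] at hs
  · rwa [hKL]

theorem proposition3p2p4 {F E : Type*} [Field F] [Finite F] [Field E] [Finite E] [Algebra F E]
    (q n : ℕ) (hq : Nat.card F = q) (hn : Module.finrank F E = n) (hn1 : 1 < n) :
    IsEssential F E (cnSources q n) := by
  subst hq hn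
  refine ⟨fun d ⟨hd, _⟩ => (Nat.mem_properDivisors.1 hd).1, fun w => ⟨fun h d _ => h _, fun h => ?_⟩⟩
  have key : ∀ d ∈ (Module.finrank F E).properDivisors,
      IsNormalElement (intermediateOfDegree F E d) w := by
    intro d
    induction d using Nat.strong_induction_on with
    | _ d ih =>
      intro hd
      by_cases hsrc : ∀ s, ¬ (cnDigraph (Nat.card F) (Module.finrank F E)).Adj s ⟨d, hd⟩
      · exact h d ⟨hd, hsrc⟩
      · push Not at hsrc
        obtain ⟨⟨c, hc⟩, hne, hcd, hprime, hord⟩ := hsrc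
        have hd0 : 0 < d := Nat.pos_of_mem_properDivisors hd
        have hlt : c < d := lt_of_le_of_ne (Nat.le_of_dvd hd0 hcd) fun h => hne (Subtype.ext h)
        refine (ih c hlt hc).intermediateOfDegree_of_dvd hcd (Nat.mem_properDivisors.1 hd).1
          (s := ordMod (charFreePart (Nat.card F) (Module.finrank F E / d)) (Nat.card F ^ c)) ?_
          ((Nat.Prime.coprime_iff_not_dvd hprime).2 hord).symm
        rw [← ZMod.natCast_eq_natCast_iff, Nat.cast_pow, Nat.cast_one]
        exact pow_orderOf_eq_one _
  intro M
  rw [eq_intermediateOfDegree M]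
  have hdvd : Module.finrank F M ∣ Module.finrank F E :=
    ⟨_, (Module.finrank_mul_finrank F M E).symm⟩
  rcases (Nat.le_of_dvd (by omega) hdvd).lt_or_eq with hlt | heq
  · exact key _ (Nat.mem_properDivisors.2 ⟨hdvd, hlt⟩)
  -- `E` itself is not a vertex; normality over it follows from that over `F`, the congruence being
  -- modulo `1`.
  · refine (key 1 (Nat.one_mem_properDivisors_iff_one_lt.2 hn1)).intermediateOfDegree_of_dvd
      (one_dvd _) hdvd (s := 1) ?_ (Nat.coprime_one_left _)
    rw [heq, Nat.div_self (by omega), charFreePart, Nat.factorization_one]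
    simpa using Nat.modEq_one
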